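/- **Setting.** Let $\mathcal S,\mathcal A$ be finite sets with $S=|\mathcal S|$, $A=|\mathcal A|$, let $H\ge 1$ be the episode length, $s^1\in\mathcal S$ a fixed initial state, $P$ a transition probability function, and $r,c:\mathcal S\times\mathcal A\to[0,1]$ an objective cost and a constraint cost. For a non-stationary randomized policy $\pi=(\pi^h)_{h=1}^H$, a transition function $P'$ and a cost $l$, let $V_l^{\pi}(P')=\mathbb E\big[\sum_{h=1}^H l(s^h,a^h)\big]$, where the episode starts in $s^1$, $a^h\sim\pi^h(s^h,\cdot)$ and $s^{h+1}\sim P'(\cdot\mid s^h,a^h)$. Let $\pi_b$ be a baseline policy with $V_c^{\pi_b}(P)=\bar C_b<\bar C$, where $\bar C-\bar C_b\le H$. Let $\delta\in(0,1)$, let $K$ be the number of episodes and $L=\log(2SAHK/\delta)$. For episode $k\in\{1,\dots,K\}$ let $n_k(s,a)$ and $n_k(s,a,s')$ be the numbers of occurrences of $(s,a)$ and of $(s,a)\to s'$ in episodes $1,\dots,k-1$, and put $\widehat P_k(s'|s,a)=\frac{n_k(s,a,s')}{n_k(s,a)\vee 1}$, $$\beta_k(s,a,s')=\sqrt{\frac{4\,\widehat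 P_k(s'|s,a)\,(1-\widehat P_k(s'|s,a))\,L}{n_k(s,a)\vee 1}}+\frac{14L}{3\,(n_k(s,a)\vee 1)},\qquad \bar\beta_k(s,a)=\sum_{s'\in\mathcal S}\beta_k(s,a,s'),$$ $$\mathcal P_k=\{P' : |P'(s'|s,a)-\widehat P_k(s'|s,a)|\le\beta_k(s,a,s')\ \ \forall s,a,s'\},$$ $$c_k=c+H\bar\beta_k,\qquad r_k=r-\frac{H^2}{\bar C-\bar C_b}\,\bar\beta_k .$$ The optimistic-pessimistic (OP) problem of episode $k$ is to minimize $V_{r_k}^{\pi'}(P')$ over all policies $\pi'$ and all transition functions $P'\in\mathcal P_k$ subject to $V_{c_k}^{\pi'}(P')\le\bar C$. The OPSRL algorithm with input $K_o$ employs $\pi_k=\pi_b$ in the episodes $k\le K_o$, and in each episode $k>K_o$ the policy component $\pi_k$ of a solution $(\pi_k,P_k)$ of the OP problem (an arbitrary policy depending on the past if there is no solution). The episodes are generated by the true model $P$. **Proposition.** There are universal constants $C>0$ and $p\in\mathbb N$ such that, in every such setting, OPSRL run with any $$K_o\ \ge\ C\,\frac{S^2AH^3}{(\bar C-\bar C_b)^2}\,L^{p}$$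 has the following property: with probability greater than $1-3\delta$, the pair $(\pi_b,P)$ is feasible for the OP problem of episode $k$, i.e. $P\in\mathcal P_k$ and $V_{c_k}^{\pi_b}(P)\le\bar C$, simultaneously for all $k\in\{1,\dots,K\}$ with $k\ge K_o$. In particular this holds with $K_o=\tilde{\mathcal O}\big(\frac{S^2AH^3}{(\bar C-\bar C_b)^2}\big)$. -/

import Mathlib

namespace OPSRL

open Finset

universe u v

/-- A transition probability function: `P s a s'` is the probability of moving from `s` to `s'`
under action `a`. -/
abbrev Model (St : Type u) (Ac : Type v) := St → Ac → PMF St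

/-- A non-stationary randomized policy over the horizon `H` (time steps are indexed from `0`). -/
abbrev Policy (St : Type u) (Ac : Type v) (H : ℕ) := Fin H → St → PMF Ac

/-- The trajectory of one episode of length `H`: the `H + 1` visited states (including the state
observed after the last action) and the `H` actions. -/
abbrev Episode (St : Type u) (Ac : Type v) (H : ℕ) := (Fin (H + 1) → St) × (Fin H → Ac)

/-- The law of an episode started in `s₁`, with actions drawn from `π` and next states drawn
from `P`, built up one time step at a time. -/
noncomputable def episodeLaw {St : Type u} {Ac : Type v} (P : Model St Ac) (s₁ : St) :
    (H : ℕ) → Policy St Ac H → PMF (Episode St Ac H)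
  | 0, _ => PMF.pure (fun _ => s₁, Fin.elim0)
  | H + 1, π =>
    (episodeLaw P s₁ H fun h => π h.castSucc).bind fun τ =>
      (π (Fin.last H) (τ.1 (Fin.last H))).bind fun a =>
        (P (τ.1 (Fin.last H)) a).bind fun s' =>
          PMF.pure (Fin.snoc (α := fun _ => St) τ.1 s', Fin.snoc (α := fun _ => Ac) τ.2 a)

/-- The value `V_l^π(P)`: the expected cumulative cost `l` over one episode started in `s₁`. -/
noncomputable def value {St : Type u} {Ac : Type v} [Fintype St] [Fintype Ac] {H : ℕ} (s₁ : St)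
    (l : St → Ac → ℝ) (π : Policy St Ac H) (P : Model St Ac) : ℝ :=
  ∑ τ : Episode St Ac H,
    (episodeLaw P s₁ H π τ).toReal * ∑ h : Fin H, l (τ.1 h.castSucc) (τ.2 h)

section Estimation

variable {St : Type u} {Ac : Type v} [DecidableEq St] [DecidableEq Ac] {H m : ℕ}

/-- `n(s, a)`: the number of visits to `(s, a)` in the `m` past episodes. -/
def visits (past : Fin m → Episode St Ac H) (s : St) (a : Ac) : ℕ :=
  ∑ j : Fin m, ∑ h : Fin H,
    if (past j).1 h.castSucc = s ∧ (past j).2 h = a then 1 else 0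

/-- `n(s, a, s')`: the number of observed transitions `(s, a) → s'` in the `m` past episodes. -/
def transitions (past : Fin m → Episode St Ac H) (s : St) (a : Ac) (s' : St) : ℕ :=
  ∑ j : Fin m, ∑ h : Fin H,
    if (past j).1 h.castSucc = s ∧ (past j).2 h = a ∧ (past j).1 h.succ = s' then 1 else 0

/-- The empirical model `n(s, a, s') / (n(s, a) ∨ 1)`. -/
noncomputable def empModel (past : Fin m → Episode St Ac H) (s : St) (a : Ac) (s' : St) : ℝ :=
  (transitions past s a s' : ℝ) / max (visits past s a : ℝ) 1

/-- The logarithmic factor `L = log (2 S A H K / δ)`. -/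
noncomputable def logFactor (St : Type u) (Ac : Type v) [Fintype St] [Fintype Ac]
    (H K : ℕ) (δ : ℝ) : ℝ :=
  Real.log (2 * Fintype.card St * Fintype.card Ac * H * K / δ)

variable [Fintype St] [Fintype Ac]

/-- The confidence radius `β(s, a, s')`, where `K` is the total number of episodes. -/
noncomputable def radius (K : ℕ) (δ : ℝ) (past : Fin m → Episode St Ac H)
    (s : St) (a : Ac) (s' : St) : ℝ :=
  √(4 * (empModel past s a s' * (1 - empModel past s a s')) * logFactor St Ac H K δ
      / max (visits past s a : ℝ) 1)
    + 14 * logFactor St Ac H K δ / (3 * max (visits past s a : ℝ) 1)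

/-- The summed radius `∑_{s'} β(s, a, s')`. -/
noncomputable def totalRadius (K : ℕ) (δ : ℝ) (past : Fin m → Episode St Ac H)
    (s : St) (a : Ac) : ℝ :=
  ∑ s' : St, radius K δ past s a s'

/-- The confidence set of models around the empirical model. -/
def confidenceSet (K : ℕ) (δ : ℝ) (past : Fin m → Episode St Ac H) : Set (Model St Ac) :=
  {P' | ∀ s a s', |(P' s a s').toReal - empModel past s a s'| ≤ radius K δ past s a s'}

/-- The pessimistic constraint cost. -/
noncomputable def pessCost (K : ℕ) (δ : ℝ) (c : St → Ac → ℝ) (past : Fin m → Episode St Ac H)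
    (s : St) (a : Ac) : ℝ :=
  c s a + H * totalRadius K δ past s a

/-- The optimistic objective cost. -/
noncomputable def optCost (K : ℕ) (δ : ℝ) (r : St → Ac → ℝ) (Cbar Cb : ℝ)
    (past : Fin m → Episode St Ac H) (s : St) (a : Ac) : ℝ :=
  r s a - (H : ℝ) ^ 2 / (Cbar - Cb) * totalRadius K δ past s a

/-- `(π', P')` is feasible for the optimistic-pessimistic problem of the episode that follows the
episodes `past`. -/
def IsOPFeasible (K : ℕ) (δ : ℝ) (s₁ : St) (c : St → Ac → ℝ) (Cbar : ℝ)
    (past : Fin m → Episode St Ac H) (π' : Policy St Ac H) (P' : Model St Ac) : Prop :=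
  P' ∈ confidenceSet K δ past ∧ value s₁ (pessCost K δ c past) π' P' ≤ Cbar

/-- `(π', P')` solves the optimistic-pessimistic problem: it is feasible and minimizes the
optimistic objective among all feasible pairs. -/
def IsOPSolution (K : ℕ) (δ : ℝ) (s₁ : St) (r c : St → Ac → ℝ) (Cbar Cb : ℝ)
    (past : Fin m → Episode St Ac H) (π' : Policy St Ac H) (P' : Model St Ac) : Prop :=
  IsOPFeasible K δ s₁ c Cbar past π' P' ∧
    ∀ (π'' : Policy St Ac H) (P'' : Model St Ac), IsOPFeasible K δ s₁ c Cbar past π'' P'' →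
      value s₁ (optCost K δ r Cbar Cb past) π' P' ≤ value s₁ (optCost K δ r Cbar Cb past) π'' P''

end Estimation

/-- A learning algorithm: `alg m past` is the policy that it employs in episode number `m + 1`
after having observed the first `m` episodes `past`. -/
abbrev Algorithm (St : Type u) (Ac : Type v) (H : ℕ) :=
  (m : ℕ) → (Fin m → Episode St Ac H) → Policy St Ac H

/-- The joint law of the first `m` episodes when the algorithm `alg` interacts with the true
model `P`, every episode starting in `s₁`. -/
noncomputable def runLaw {St : Type u} {Ac : Type v} {H : ℕ} (P : Model St Ac) (s₁ : St)
    (alg : Algorithm St Ac H) : (m : ℕ) → PMF (Fin m → Episode St Ac H)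
  | 0 => PMF.pure Fin.elim0
  | m + 1 =>
    (runLaw P s₁ alg m).bind fun past =>
      (episodeLaw P s₁ H (alg m past)).bind fun τ =>
        PMF.pure (Fin.snoc (α := fun _ => Episode St Ac H) past τ)

/-- The first `m` of the `K` episodes of a run. -/
def firstEpisodes {St : Type u} {Ac : Type v} {H K : ℕ} (ω : Fin K → Episode St Ac H)
    (m : ℕ) (hm : m ≤ K) : Fin m → Episode St Ac H :=
  fun j => ω (Fin.castLE hm j)

/-- `alg` is an OPSRL algorithm for `K` episodes with input `δ, r, c, π_b, C_b, C̄, K_o`. In the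
episodes `k ≤ K_o` it employs the baseline policy; in each episode `k > K_o` it employs the policy
component of a solution of the optimistic-pessimistic problem (an arbitrary policy when that
problem has no solution). -/
structure IsOPSRL {St : Type u} {Ac : Type v} [Fintype St] [Fintype Ac] [DecidableEq St]
    [DecidableEq Ac] {H : ℕ} (K : ℕ) (δ : ℝ) (s₁ : St) (r c : St → Ac → ℝ)
    (πb : Policy St Ac H) (Cb Cbar : ℝ) (Ko : ℕ) (alg : Algorithm St Ac H) : Prop where
  baseline : ∀ (m : ℕ) (past : Fin m → Episode St Ac H), m + 1 ≤ Ko → alg m past = πb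
  solution : ∀ (m : ℕ) (past : Fin m → Episode St Ac H), Ko < m + 1 → m + 1 ≤ K →
    (∃ (π' : Policy St Ac H) (P' : Model St Ac), IsOPSolution K δ s₁ r c Cbar Cb past π' P') →
      ∃ P' : Model St Ac, IsOPSolution K δ s₁ r c Cbar Cb past (alg m past) P'

end OPSRL

/-!
The baseline pair `(π_b, P)` is feasible once two events hold, each of which fails with probability
at most `δ / 2`.

*The true model lies in every confidence set.* For a fixed triple `(s, a, s')` a bettor who wagers
at each visit of `(s, a)` on whether the next state is `s'`, at odds that are fair under `P`, has
expected capital at most one whatever the learner does (`expect_bet_le_one`). Given a visit count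
`n`, the odds can be chosen so that the capital is at least `exp (2 L)` as soon as the empirical
frequency errs by more than the radius, on a fixed side (`exists_fair_bet`). This rests on a lower
bound for the Bernoulli relative entropy in terms of the variance of the *empirical* law
(`sq_div_le_kl`). Markov's inequality and a union bound over episodes, triples, counts `n ≤ H K`
and sides cost `2 S² A H K²` times `exp (-2 L) = (δ / (2 S A H K))²`, which is why one factor `S`
inside the logarithm suffices although there are `S²` pairs of states.

*The baseline episodes visit every pair often enough.* Let `w (s, a)` be the expected number of
visits in an episode of `π_b`. As the count of one episode lies in `[0, H]`, a multiplicative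
Chernoff bound shows that after `M = K_o - 1` episodes the count is at least `M w / 4 - H L`,
except with probability `exp (-L)` (`prob_visits_lt_le`).

On both events the pessimistic surplus `H ∑ w (s, a) ∑_{s'} β (s, a, s')` is bounded
deterministically. By the Cauchy-Schwarz inequality over `s'` the inner sum is at most
`√(4 S L / n) + 14 S L / (3 n)`. The weight `w` is either of order `n / M`, so that `w √(S L / n)`
is of order `√(w S L / M)`, or of order `H L / M`, so that the pair hardly matters. As the weights
sum to `H`, a second use of the Cauchy-Schwarz inequality bounds the surplus by a constant times
`√(S² A H³ L / M) + S² A H² L² / M` (`value_totalRadius_le`). This is at most the slack `C̄ - C̄_b`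
for the prescribed `K_o`, with constants `C = 400` and `p = 2`; in the second term one uses that
the slack is at most `H` (`mul_sqrt_add_le_gap`).
-/

namespace OPSRL

open Finset

/-! ### Expectations and probabilities on finite types -/

/-- The expectation of a real function under a probability mass function on a finite type. -/
noncomputable def expect {α : Type*} [Fintype α] (μ : PMF α) (f : α → ℝ) : ℝ :=
  ∑ x, (μ x).toReal * f x

/-- The probability of an event as a real number. -/
noncomputable def prob {α : Type*} (μ : PMF α) (s : Set α) : ℝ :=
  (μ.toOuterMeasure s).toReal

section Expect

variable {α β : Type*} [Fintype α] [Fintype β]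

lemma sum_toReal_eq_one (μ : PMF α) : ∑ x, (μ x).toReal = 1 := by
  rw [← ENNReal.toReal_sum (fun x _ => μ.apply_ne_top x), ← tsum_fintype (L := .unconditional _),
    μ.tsum_coe, ENNReal.toReal_one]

lemma expect_const (μ : PMF α) (c : ℝ) : expect μ (fun _ => c) = c := by
  simp [expect, ← Finset.sum_mul, sum_toReal_eq_one]

lemma expect_mono (μ : PMF α) {f g : α → ℝ} (h : ∀ x, f x ≤ g x) : expect μ f ≤ expect μ g :=
  Finset.sum_le_sum fun x _ => mul_le_mul_of_nonneg_left (h x) ENNReal.toReal_nonneg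

lemma expect_nonneg (μ : PMF α) {f : α → ℝ} (h : ∀ x, 0 ≤ f x) : 0 ≤ expect μ f :=
  Finset.sum_nonneg fun x _ => mul_nonneg ENNReal.toReal_nonneg (h x)

lemma expect_const_mul (μ : PMF α) (c : ℝ) (f : α → ℝ) :
    expect μ (fun x => c * f x) = c * expect μ f := by
  simp only [expect, Finset.mul_sum]
  exact Finset.sum_congr rfl fun x _ => by ring

lemma expect_sum {ι : Type*} (μ : PMF α) (t : Finset ι) (f : ι → α → ℝ) :
    expect μ (fun x => ∑ i ∈ t, f i x) = ∑ i ∈ t, expect μ (f i) := by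
  simp only [expect, Finset.mul_sum]
  exact Finset.sum_comm

lemma expect_pure (x : α) (f : α → ℝ) : expect (PMF.pure x) f = f x := by
  classical
  rw [expect, Finset.sum_eq_single x] <;> simp +contextual [PMF.pure_apply]

lemma expect_bind (μ : PMF α) (k : α → PMF β) (f : β → ℝ) :
    expect (μ.bind k) f = expect μ (fun x => expect (k x) f) := by
  have h (y : β) : ((μ.bind k) y).toReal = ∑ x, (μ x).toReal * (k x y).toReal := by
    rw [PMF.bind_apply, tsum_fintype, ENNReal.toReal_sum]
    · simp
    · exact fun x _ => ENNReal.mul_ne_top (μ.apply_ne_top x) ((k x).apply_ne_top y)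
  simp only [expect, h, Finset.sum_mul, Finset.mul_sum]
  rw [Finset.sum_comm]
  exact Finset.sum_congr rfl fun x _ => Finset.sum_congr rfl fun y _ => by ring

lemma prob_eq_expect (μ : PMF α) (s : Set α) : prob μ s = expect μ (s.indicator 1) := by
  classical
  rw [prob, PMF.toOuterMeasure_apply_fintype, ENNReal.toReal_sum]
  · refine Finset.sum_congr rfl fun x _ => ?_
    by_cases hx : x ∈ s <;> simp [hx]
  · intro x _
    by_cases hx : x ∈ s <;> simp [hx, μ.apply_ne_top]

lemma prob_mono (μ : PMF α) {s t : Set α} (h : s ⊆ t) : prob μ s ≤ prob μ t := by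
  simp only [prob_eq_expect]
  exact expect_mono μ fun x => Set.indicator_le_indicator_of_subset h (fun _ => zero_le_one) x

lemma prob_compl (μ : PMF α) (s : Set α) : prob μ sᶜ = 1 - prob μ s := by
  rw [eq_sub_iff_add_eq, prob_eq_expect, prob_eq_expect, ← expect_const μ 1]
  simp only [expect, ← Finset.sum_add_distrib, ← mul_add]
  refine Finset.sum_congr rfl fun x _ => ?_
  by_cases hx : x ∈ s <;> simp [hx]

lemma prob_exists_le {ι : Type*} (t : Finset ι) (μ : PMF α) (s : ι → Set α) :
    prob μ {x | ∃ i ∈ t, x ∈ s i} ≤ ∑ i ∈ t, prob μ (s i) := by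
  simp only [prob_eq_expect]
  rw [← expect_sum]
  refine expect_mono μ fun x => ?_
  have h0 (i : ι) : 0 ≤ (s i).indicator (1 : α → ℝ) x :=
    Set.indicator_nonneg (fun _ _ => zero_le_one) x
  by_cases hx : ∃ i ∈ t, x ∈ s i
  · obtain ⟨i, hi, hxi⟩ := hx
    rw [Set.indicator_of_mem (show x ∈ {x | ∃ i ∈ t, x ∈ s i} from ⟨i, hi, hxi⟩)]
    calc (1 : α → ℝ) x = (s i).indicator (1 : α → ℝ) x := by simp [hxi]
      _ ≤ _ := Finset.single_le_sum (f := fun i => (s i).indicator (1 : α → ℝ) x)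
          (fun i _ => h0 i) hi
  · rw [Set.indicator_of_notMem (by simpa using hx)]
    exact Finset.sum_nonneg fun i _ => h0 i

lemma prob_union_le (μ : PMF α) (s t : Set α) : prob μ (s ∪ t) ≤ prob μ s + prob μ t := by
  refine (prob_mono μ (t := {x | ∃ b ∈ univ, x ∈ cond b s t}) ?_).trans
    ((prob_exists_le univ μ fun b : Bool => cond b s t).trans (by simp))
  rintro x (hx | hx)
  · exact ⟨true, mem_univ _, hx⟩
  · exact ⟨false, mem_univ _, hx⟩

/-- Markov's inequality, with the threshold `c⁻¹`. -/
lemma prob_le_mul_expect (μ : PMF α) {s : Set α} {f : α → ℝ} {c : ℝ} (hc : 0 ≤ c)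
    (hf : ∀ x, 0 ≤ f x) (h : ∀ x ∈ s, 1 ≤ c * f x) : prob μ s ≤ c * expect μ f := by
  rw [prob_eq_expect, ← expect_const_mul]
  refine expect_mono μ fun x => ?_
  by_cases hx : x ∈ s
  · simpa [hx] using h x hx
  · simpa [hx] using mul_nonneg hc (hf x)

end Expect

/-! ### A betting strategy against Bernoulli deviations -/

/-- The relative entropy `KL(q ‖ p)` of Bernoulli laws is at least `(p - q)² / (2 (v + (p - q)))`,
where `v = q (1 - q)` is the variance at the *first* argument, so that `v + (p - q) = p - q²`.
This is because `∂KL/∂p = (p - q) / (p (1 - p))` and `p (1 - p) ≤ v + (p - q)`. -/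
lemma sq_div_le_kl {q p : ℝ} (hq : 0 ≤ q) (hqp : q < p) (hp : p < 1) :
    (p - q) ^ 2 / (2 * (p - q ^ 2)) ≤
      q * (Real.log q - Real.log p) + (1 - q) * (Real.log (1 - q) - Real.log (1 - p)) := by
  rcases hq.eq_or_lt with rfl | hq
  · have h := Real.log_le_sub_one_of_pos (x := 1 - p) (by linarith)
    have : (p - 0) ^ 2 / (2 * (p - 0 ^ 2)) = p / 2 := by
      field_simp [hqp.ne']
      ring
    rw [this]
    simp
    linarith
  let F : ℝ → ℝ := fun t =>
    q * (Real.log q - Real.log t) + (1 - q) * (Real.log (1 - q) - Real.log (1 - t))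
      - (t - q) ^ 2 / (2 * (t - q ^ 2))
  have hder : ∀ t ∈ Set.Icc q p, HasDerivAt F
      (q * (-t⁻¹) + (1 - q) * (-((-1) / (1 - t)))
        - ((2 * (t - q)) * (2 * (t - q ^ 2)) - (t - q) ^ 2 * 2) / (2 * (t - q ^ 2)) ^ 2) t := by
    intro t ht
    have ht0 : t ≠ 0 := (hq.trans_le ht.1).ne'
    have ht1 : 1 - t ≠ 0 := by linarith [ht.2]
    have ht2 : 2 * (t - q ^ 2) ≠ 0 := by nlinarith [ht.1]
    have h1 : HasDerivAt (fun t => Real.log q - Real.log t) (-t⁻¹) t :=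
      (Real.hasDerivAt_log ht0).const_sub _
    have h2 : HasDerivAt (fun t => Real.log (1 - q) - Real.log (1 - t)) (-((-1) / (1 - t))) t :=
      (((hasDerivAt_id t).const_sub 1).log ht1).const_sub _
    have h3 : HasDerivAt (fun t => (t - q) ^ 2) (2 * (t - q)) t := by
      simpa using ((hasDerivAt_id t).sub_const q).fun_pow 2
    have h4 : HasDerivAt (fun t => 2 * (t - q ^ 2)) 2 t := by
      simpa using ((hasDerivAt_id t).sub_const (q ^ 2)).const_mul 2
    exact ((h1.const_mul q).add (h2.const_mul (1 - q))).sub (h3.div h4 ht2)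
  have hmono : MonotoneOn F (Set.Icc q p) := by
    refine monotoneOn_of_deriv_nonneg (convex_Icc q p)
      (fun t ht => (hder t ht).continuousAt.continuousWithinAt)
      (fun t ht => (hder t (interior_subset ht)).differentiableAt.differentiableWithinAt) ?_
    intro t ht
    rw [interior_Icc] at ht
    rw [(hder t ⟨ht.1.le, ht.2.le⟩).deriv]
    have ht0 : 0 < t := hq.trans ht.1
    have ht1 : 0 < 1 - t := by linarith [ht.2]
    have hd : 0 < t - q := by linarith [ht.1]
    have hw : 0 < t - q ^ 2 := by nlinarith [ht.1]
    have e1 : q * (-t⁻¹) + (1 - q) * (-((-1) / (1 - t))) = (t - q) / (t * (1 - t)) := by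
      field_simp
      ring
    have e2 : (t - q) / (t - q ^ 2) ≤ (t - q) / (t * (1 - t)) :=
      div_le_div_of_nonneg_left hd.le (mul_pos ht0 ht1) (by nlinarith)
    have e3 : ((2 * (t - q)) * (2 * (t - q ^ 2)) - (t - q) ^ 2 * 2) / (2 * (t - q ^ 2)) ^ 2
        ≤ (t - q) / (t - q ^ 2) := by
      rw [div_le_div_iff₀ (by positivity) hw]
      nlinarith [mul_pos (mul_pos hd hd) hw]
    rw [e1]
    linarith
  have h := hmono (Set.left_mem_Icc.2 hqp.le) (Set.right_mem_Icc.2 hqp.le) hqp.le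
  simp only [F, sub_self] at h
  norm_num at h
  linarith

/-- For a Bernoulli variable of mean `p`, there is a fair bet, paying `b` on success and `a` on
failure, whose capital after `n` rounds is at least `exp (2 L)` whenever the number `j` of
successes is so small that `p` exceeds the empirical Bernstein upper bound. The bet is the
likelihood ratio of Bernoulli laws at the largest such `j`. -/
lemma exists_fair_bet {p L : ℝ} (hp0 : 0 ≤ p) (hp1 : p ≤ 1) {n : ℕ} (hn : 0 < n) (hL : 0 < L) :
    ∃ b a : ℝ, 0 ≤ b ∧ 0 ≤ a ∧ p * b + (1 - p) * a = 1 ∧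
      ∀ j ≤ n, √(4 * ((j : ℝ) / n * (1 - j / n)) * L / n) + 14 * L / (3 * n) < p - j / n →
        Real.exp (2 * L) ≤ b ^ j * a ^ (n - j) := by
  classical
  let bad : Finset ℕ := {j ∈ range (n + 1) |
    √(4 * ((j : ℝ) / n * (1 - j / n)) * L / n) + 14 * L / (3 * n) < p - j / n}
  have hn' : (0 : ℝ) < n := by exact_mod_cast hn
  rcases bad.eq_empty_or_nonempty with hbad | hbad
  · refine ⟨1, 1, zero_le_one, zero_le_one, by ring, fun j hj h => ?_⟩
    have : j ∈ bad := mem_filter.2 ⟨mem_range.2 (by omega), h⟩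
    simp [hbad] at this
  obtain ⟨i, hi, hmax⟩ := bad.exists_max_image id hbad
  have hle : ∀ j ≤ n, √(4 * ((j : ℝ) / n * (1 - j / n)) * L / n) + 14 * L / (3 * n) < p - j / n →
      j ≤ i := fun j hj h => hmax j (mem_filter.2 ⟨mem_range.2 (by omega), h⟩)
  simp only [bad, mem_filter, mem_range] at hi
  obtain ⟨hin, hdev⟩ := hi
  set q : ℝ := i / n with hq
  set B : ℝ := 14 * L / (3 * n) with hB
  have hB0 : 0 < B := by positivity
  have hsq := Real.sqrt_nonneg (4 * (q * (1 - q)) * L / n)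
  have hq0 : 0 ≤ q := by positivity
  have hqp : q < p := by linarith
  have hi1 : i < n := by
    have : (i : ℝ) < n := by rw [← div_lt_one hn']; linarith
    exact_mod_cast this
  rcases hp1.eq_or_lt with rfl | hp1
  -- If `p = 1`, failures are impossible, and betting arbitrarily much on them is free.
  · refine ⟨1, Real.exp (2 * L), zero_le_one, (Real.exp_pos _).le, by ring, fun j hj h => ?_⟩
    have hji := hle j hj h
    rw [one_pow, one_mul]
    exact le_self_pow₀ (Real.one_le_exp (by linarith)) (by omega)
  have hp : 0 < p := hq0.trans_lt hqp
  have h1p : 0 < 1 - p := by linarith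
  have h1q : 0 < 1 - q := by linarith
  have hb0 : 0 ≤ q / p := by positivity
  have hb1 : q / p ≤ 1 := by rw [div_le_one hp]; exact hqp.le
  have ha1 : 1 ≤ (1 - q) / (1 - p) := by rw [one_le_div h1p]; linarith
  refine ⟨q / p, (1 - q) / (1 - p), hb0, by positivity, by field_simp; ring, fun j hj h => ?_⟩
  have hji := hle j hj h
  have hpow : (q / p) ^ i * ((1 - q) / (1 - p)) ^ (n - i)
      ≤ (q / p) ^ j * ((1 - q) / (1 - p)) ^ (n - j) :=
    mul_le_mul (pow_le_pow_of_le_one hb0 hb1 hji) (pow_le_pow_right₀ ha1 (by omega))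
      (by positivity) (by positivity)
  refine le_trans ?_ hpow
  have hni : ((n - i : ℕ) : ℝ) = n * (1 - q) := by
    rw [Nat.cast_sub hi1.le, hq]; field_simp
  have hiq : (i : ℝ) = n * q := by rw [hq]; field_simp
  have hbpow : (q / p) ^ i = Real.exp (n * (q * (Real.log q - Real.log p))) := by
    rcases Nat.eq_zero_or_pos i with h0 | h0
    · have : q = 0 := by simp [hq, h0]
      simp [h0, this]
    · have hqpos : 0 < q := by positivity
      rw [← Real.log_div hqpos.ne' hp.ne', ← mul_assoc, ← hiq, Real.exp_nat_mul,
        Real.exp_log (by positivity)]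
  have hapow : ((1 - q) / (1 - p)) ^ (n - i)
      = Real.exp (n * ((1 - q) * (Real.log (1 - q) - Real.log (1 - p)))) := by
    rw [← Real.log_div h1q.ne' h1p.ne', ← mul_assoc, ← hni, Real.exp_nat_mul,
      Real.exp_log (by positivity)]
  rw [hbpow, hapow, ← Real.exp_add, Real.exp_le_exp, ← mul_add]
  refine le_trans ?_ (mul_le_mul_of_nonneg_left (sq_div_le_kl hq0 hqp hp1) hn'.le)
  have hw : 0 < p - q ^ 2 := by nlinarith
  have hA := Real.sq_sqrt (show 0 ≤ 4 * (q * (1 - q)) * L / n by positivity)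
  set A := √(4 * (q * (1 - q)) * L / n)
  -- With `d = p - q > A + B`, one has `d² ≥ A² + B d`.
  have hd2 : A ^ 2 + B * (p - q) ≤ (p - q) ^ 2 := by nlinarith
  rw [hA, hB] at hd2
  have hd3 : 4 * (q * (1 - q)) * L + 14 * L / 3 * (p - q) ≤ n * (p - q) ^ 2 := by
    calc _ = n * (4 * (q * (1 - q)) * L / n + 14 * L / (3 * n) * (p - q)) := by field_simp
      _ ≤ _ := mul_le_mul_of_nonneg_left hd2 hn'.le
  rw [← mul_div_assoc, le_div_iff₀ (by positivity)]
  nlinarith [mul_pos hL (sub_pos.2 hqp)]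

/-! ### Product functionals of episodes and runs -/

section Trajectories

variable {St : Type*} {Ac : Type*} {H K : ℕ}

/-- The product of a weight `g s a s'` over all transitions of an episode. -/
def pathWeight (g : St → Ac → St → ℝ) (τ : Episode St Ac H) : ℝ :=
  ∏ h : Fin H, g (τ.1 h.castSucc) (τ.2 h) (τ.1 h.succ)

lemma pathWeight_snoc (g : St → Ac → St → ℝ) (τ : Episode St Ac H) (a : Ac) (s' : St) :
    pathWeight (H := H + 1) g (Fin.snoc (α := fun _ => St) τ.1 s', Fin.snoc (α := fun _ => Ac) τ.2 a)
      = pathWeight g τ * g (τ.1 (Fin.last H)) a s' := by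
  simp only [pathWeight, Fin.prod_univ_castSucc, Fin.snoc_castSucc, Fin.snoc_last, Fin.succ_last,
    Fin.succ_castSucc]

lemma firstEpisodes_snoc {m : ℕ} (hm : m ≤ K) (past : Fin K → Episode St Ac H)
    (τ : Episode St Ac H) :
    firstEpisodes (K := K + 1) (Fin.snoc (α := fun _ => Episode St Ac H) past τ) m
      (hm.trans K.le_succ) = firstEpisodes past m hm := by
  funext j
  have : Fin.castLE (hm.trans K.le_succ) j = (Fin.castLE hm j).castSucc := rfl
  simp only [firstEpisodes, this, Fin.snoc_castSucc]

variable [Fintype St] [Fintype Ac]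

/-- A weight with conditional mean one in every state and action yields an exponential martingale
along an episode, whatever the policy. -/
lemma expect_pathWeight {P : Model St Ac} {g : St → Ac → St → ℝ}
    (hg : ∀ s a, expect (P s a) (g s a) = 1) (s₁ : St) (π : Policy St Ac H) :
    expect (episodeLaw P s₁ H π) (pathWeight g) = 1 := by
  induction H with
  | zero => simp [episodeLaw, expect_pure, pathWeight]
  | succ H ih =>
    simp only [episodeLaw, expect_bind, expect_pure, pathWeight_snoc, expect_const_mul, hg,
      mul_one, expect_const]
    exact ih _

/-- The first `m` episodes of a run of `K` episodes form a run of `m` episodes. -/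
lemma expect_runLaw_firstEpisodes (P : Model St Ac) (s₁ : St) (alg : Algorithm St Ac H) {m : ℕ}
    (hm : m ≤ K) (f : (Fin m → Episode St Ac H) → ℝ) :
    expect (runLaw P s₁ alg K) (fun ω => f (firstEpisodes ω m hm))
      = expect (runLaw P s₁ alg m) f := by
  induction K, hm using Nat.le_induction with
  | base => rfl
  | succ K hm ih =>
    simp only [runLaw, expect_bind, expect_pure, firstEpisodes_snoc hm, expect_const]
    exact ih

lemma prob_runLaw_firstEpisodes (P : Model St Ac) (s₁ : St) (alg : Algorithm St Ac H) {m : ℕ}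
    (hm : m ≤ K) (s : Set (Fin m → Episode St Ac H)) :
    prob (runLaw P s₁ alg K) {ω | firstEpisodes ω m hm ∈ s} = prob (runLaw P s₁ alg m) s := by
  rw [prob_eq_expect, prob_eq_expect, ← expect_runLaw_firstEpisodes P s₁ alg hm]
  rfl

lemma expect_runLaw_prod_le {P : Model St Ac} {s₁ : St} {alg : Algorithm St Ac H}
    {f : Episode St Ac H → ℝ} (hf : ∀ τ, 0 ≤ f τ) {κ : ℝ} (m : ℕ)
    (h : ∀ k < m, ∀ past, expect (episodeLaw P s₁ H (alg k past)) f ≤ κ) :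
    expect (runLaw P s₁ alg m) (fun past => ∏ j, f (past j)) ≤ κ ^ m := by
  induction m with
  | zero => simp [expect_const]
  | succ m ih =>
    have ih := ih fun k hk => h k (hk.trans m.lt_succ_self)
    simp only [runLaw, expect_bind, expect_pure, Fin.prod_univ_castSucc, Fin.snoc_castSucc,
      Fin.snoc_last, expect_const_mul]
    have hm := h m m.lt_succ_self
    rcases le_or_gt 0 κ with hκ | hκ
    · calc _ ≤ expect (runLaw P s₁ alg m) (fun past => κ * ∏ j, f (past j)) :=
            expect_mono _ fun past => by
              rw [mul_comm κ]
              exact mul_le_mul_of_nonneg_left (hm past) (prod_nonneg fun j _ => hf _)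
        _ ≤ κ * κ ^ m := by
              rw [expect_const_mul]
              exact mul_le_mul_of_nonneg_left ih hκ
        _ = κ ^ (m + 1) := by ring
    · obtain ⟨past, -⟩ := (runLaw P s₁ alg m).support_nonempty
      exact absurd (hm past) (not_le.2 (hκ.trans_le (expect_nonneg _ hf)))

end Trajectories

/-! ### Validity of the confidence sets -/

section Confidence

variable {St : Type*} {Ac : Type*} [DecidableEq St] [DecidableEq Ac] {H m K : ℕ}

lemma transitions_le_visits (past : Fin m → Episode St Ac H) (s : St) (a : Ac) (s' : St) :
    transitions past s a s' ≤ visits past s a := by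
  refine sum_le_sum fun j _ => sum_le_sum fun h _ => ?_
  split_ifs <;> first | omega | tauto

lemma visits_le (past : Fin m → Episode St Ac H) (s : St) (a : Ac) : visits past s a ≤ H * m := by
  calc visits past s a ≤ ∑ _j : Fin m, ∑ _h : Fin H, 1 :=
        sum_le_sum fun j _ => sum_le_sum fun h _ => by split_ifs <;> simp
    _ = H * m := by simp [mul_comm]

/-- The one-step capital of a bettor who, at each visit of `(s, a)`, bets on the next state being
`s'` or not; the capital is multiplied by `b` or `a'` respectively. -/
def betWeight (s : St) (a : Ac) (s' : St) (b a' : ℝ) (x : St) (u : Ac) (y : St) : ℝ :=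
  if x = s ∧ u = a then (if y = s' then b else a') else 1

lemma prod_pathWeight_betWeight (past : Fin m → Episode St Ac H) (s : St) (a : Ac) (s' : St)
    (b a' : ℝ) :
    ∏ j, pathWeight (betWeight s a s' b a') (past j)
      = b ^ transitions past s a s' * a' ^ (visits past s a - transitions past s a s') := by
  have hsub : visits past s a - transitions past s a s' =
      ∑ j : Fin m, ∑ h : Fin H, if (past j).1 h.castSucc = s ∧ (past j).2 h = a ∧
        ¬ (past j).1 h.succ = s' then 1 else 0 := by
    rw [Nat.sub_eq_iff_eq_add (transitions_le_visits past s a s'), visits, transitions,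
      ← sum_add_distrib]
    refine sum_congr rfl fun j _ => ?_
    rw [← sum_add_distrib]
    refine sum_congr rfl fun h _ => ?_
    split_ifs <;> first | rfl | tauto
  rw [hsub, transitions, ← prod_pow_eq_pow_sum, ← prod_pow_eq_pow_sum, ← prod_mul_distrib]
  refine prod_congr rfl fun j _ => ?_
  rw [← prod_pow_eq_pow_sum, ← prod_pow_eq_pow_sum, ← prod_mul_distrib]
  refine prod_congr rfl fun h _ => ?_
  by_cases h1 : (past j).1 h.castSucc = s ∧ (past j).2 h = a
  · by_cases h2 : (past j).1 h.succ = s' <;> simp [betWeight, h1, h2]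
  · have h3 : ∀ c : Prop, ¬ ((past j).1 h.castSucc = s ∧ (past j).2 h = a ∧ c) := by tauto
    simp [betWeight, h1, h3]

variable [Fintype St] [Fintype Ac]

lemma expect_indicator_eq (μ : PMF St) (s' : St) (b a : ℝ) :
    expect μ (fun y => if y = s' then b else a)
      = (μ s').toReal * b + (1 - (μ s').toReal) * a := by
  have h : ∀ y, (μ y).toReal * (if y = s' then b else a)
      = (μ y).toReal * a + if y = s' then (μ y).toReal * (b - a) else 0 := by
    intro y
    split_ifs <;> ring
  rw [expect, sum_congr rfl fun y _ => h y, sum_add_distrib, ← sum_mul, sum_toReal_eq_one,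
    sum_ite_eq' univ s', if_pos (mem_univ _)]
  ring

/-- A fair bet on `s'` at the visits of `(s, a)` has expected final capital at most one. -/
lemma expect_bet_le_one {P : Model St Ac} (s₁ : St) (alg : Algorithm St Ac H) (m : ℕ) {s : St}
    {a : Ac} {s' : St} {b a' : ℝ} (hb : 0 ≤ b) (ha : 0 ≤ a')
    (hfair : (P s a s').toReal * b + (1 - (P s a s').toReal) * a' = 1) :
    expect (runLaw P s₁ alg m) (fun past =>
      b ^ transitions past s a s' * a' ^ (visits past s a - transitions past s a s')) ≤ 1 := by
  simp only [← prod_pathWeight_betWeight]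
  have hg : ∀ x u, expect (P x u) (betWeight s a s' b a' x u) = 1 := by
    intro x u
    by_cases h : x = s ∧ u = a
    · obtain ⟨rfl, rfl⟩ := h
      have : betWeight x u s' b a' x u = fun y => if y = s' then b else a' := by
        funext y
        simp [betWeight]
      rw [this, expect_indicator_eq, hfair]
    · have : betWeight s a s' b a' x u = fun _ => 1 := by
        funext y
        simp [betWeight, h]
      rw [this, expect_const]
  have h0 : ∀ τ : Episode St Ac H, 0 ≤ pathWeight (betWeight s a s' b a') τ := by
    refine fun τ => prod_nonneg fun h _ => ?_
    unfold betWeight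
    split_ifs <;> first | assumption | exact zero_le_one
  simpa using expect_runLaw_prod_le (P := P) (s₁ := s₁) (alg := alg) h0 (κ := 1) m
    fun k _ past => (expect_pathWeight hg s₁ _).le

/-- The event that `(s, a)` has been visited `n` times and the empirical probability of `s'`
deviates from the true one by more than the radius has probability at most `2 exp (-2 L)`. -/
lemma prob_deviation_le (P : Model St Ac) (s₁ : St) (alg : Algorithm St Ac H) {δ : ℝ} {n : ℕ}
    (hn : 0 < n) (hL : 0 < logFactor St Ac H K δ) (m : ℕ) (s : St) (a : Ac) (s' : St) :
    prob (runLaw P s₁ alg m) {past | visits past s a = n ∧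
        radius K δ past s a s' < |(P s a s').toReal - empModel past s a s'|}
      ≤ 2 * Real.exp (-(2 * logFactor St Ac H K δ)) := by
  set L := logFactor St Ac H K δ with hLdef
  set p := (P s a s').toReal with hp
  have hp0 : 0 ≤ p := ENNReal.toReal_nonneg
  have hp1 : p ≤ 1 := ENNReal.toReal_mono ENNReal.one_ne_top ((P s a).coe_le_one s')
  have hn1 : max (n : ℝ) 1 = n := max_eq_left (by exact_mod_cast hn)
  have hn' : (0 : ℝ) < n := by exact_mod_cast hn
  obtain ⟨b, c, hb, hc, hfair, hcap⟩ := exists_fair_bet hp0 hp1 hn hL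
  -- The bet against an overestimate: exchange the roles of success and failure.
  obtain ⟨c', b', hc', hb', hfair', hcap'⟩ :=
    exists_fair_bet (p := 1 - p) (by linarith) (by linarith) hn hL
  have key : ∀ (s : Set (Fin m → Episode St Ac H)) (f : (Fin m → Episode St Ac H) → ℝ),
      (∀ x, 0 ≤ f x) → expect (runLaw P s₁ alg m) f ≤ 1 → (∀ x ∈ s, Real.exp (2 * L) ≤ f x) →
      prob (runLaw P s₁ alg m) s ≤ Real.exp (-(2 * L)) := by
    intro s f hf0 hf1 hs
    refine (prob_le_mul_expect _ (Real.exp_pos _).le hf0 fun x hx => ?_).trans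
      (mul_le_of_le_one_right (Real.exp_pos (-(2 * L))).le hf1)
    rw [Real.exp_neg, ← div_eq_inv_mul, one_le_div (Real.exp_pos _)]
    exact hs x hx
  have hlow := key {past | visits past s a = n ∧
      radius K δ past s a s' < p - empModel past s a s'} _ (fun x => by positivity)
    (expect_bet_le_one s₁ alg m hb hc hfair) (by
      rintro x ⟨hv, hx⟩
      have hj := transitions_le_visits x s a s'
      simp only [radius, empModel, hv, hn1, ← hLdef] at hx
      rw [hv] at hj ⊢
      exact hcap _ hj hx)
  have hupp := key {past | visits past s a = n ∧
      radius K δ past s a s' < empModel past s a s' - p} _ (fun x => by positivity)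
    (expect_bet_le_one s₁ alg m hb' hc' (by linarith)) (by
      rintro x ⟨hv, hx⟩
      have hj := transitions_le_visits x s a s'
      simp only [radius, empModel, hv, hn1, ← hLdef] at hx
      rw [hv] at hj ⊢
      have hsub : ((n - transitions x s a s' : ℕ) : ℝ) / n = 1 - transitions x s a s' / n := by
        rw [Nat.cast_sub hj]
        field_simp
      have := hcap' (n - transitions x s a s') (Nat.sub_le _ _) (by
        rw [hsub, sub_sub_cancel, mul_comm (1 - _ : ℝ)]
        linarith)
      rwa [Nat.sub_sub_self hj, mul_comm (c' ^ _)] at this)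
  calc _ ≤ _ := prob_mono _ ?_
    _ ≤ _ := prob_union_le _ _ _
    _ ≤ _ := add_le_add hlow hupp
    _ = _ := by ring
  rintro x ⟨hv, hx⟩
  rcases lt_abs.1 hx with h | h
  · exact Or.inl ⟨hv, h⟩
  · exact Or.inr ⟨hv, by linarith⟩

lemma mem_confidenceSet_of_visits {P : Model St Ac} {δ : ℝ} (hL : 2 / 3 < logFactor St Ac H K δ)
    (past : Fin m → Episode St Ac H)
    (h : ∀ s a s', 0 < visits past s a →
      |(P s a s').toReal - empModel past s a s'| ≤ radius K δ past s a s') :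
    P ∈ confidenceSet K δ past := by
  intro s a s'
  rcases Nat.eq_zero_or_pos (visits past s a) with h0 | h0
  · have ht : transitions past s a s' = 0 := by
      have := transitions_le_visits past s a s'
      omega
    have hp : (P s a s').toReal ≤ 1 := ENNReal.toReal_mono ENNReal.one_ne_top ((P s a).coe_le_one s')
    simp only [radius, empModel, h0, ht]
    simp only [Nat.cast_zero, zero_div, sub_zero, abs_of_nonneg ENNReal.toReal_nonneg]
    norm_num
    linarith
  · exact h s a s' h0

lemma prob_notMem_confidenceSet_le (P : Model St Ac) (s₁ : St) (alg : Algorithm St Ac H) {δ : ℝ}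
    (hL : 2 / 3 < logFactor St Ac H K δ) {m : ℕ} (hm : m ≤ K) :
    prob (runLaw P s₁ alg m) {past | P ∉ confidenceSet K δ past}
      ≤ Fintype.card St ^ 2 * Fintype.card Ac * H * K
        * (2 * Real.exp (-(2 * logFactor St Ac H K δ))) := by
  calc _ ≤ prob (runLaw P s₁ alg m) {past | ∃ i ∈ (univ : Finset (St × Ac × St)) ×ˢ Icc 1 (H * K),
          past ∈ {past | visits past i.1.1 i.1.2.1 = i.2 ∧ radius K δ past i.1.1 i.1.2.1 i.1.2.2 <
            |(P i.1.1 i.1.2.1 i.1.2.2).toReal - empModel past i.1.1 i.1.2.1 i.1.2.2|}} := by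
        refine prob_mono _ fun past hpast => ?_
        by_contra hcon
        refine hpast (mem_confidenceSet_of_visits hL past fun s a s' hv => ?_)
        by_contra hlt
        refine hcon ⟨((s, a, s'), visits past s a), mem_product.2 ⟨mem_univ _, mem_Icc.2 ⟨hv, ?_⟩⟩,
          rfl, not_le.1 hlt⟩
        exact (visits_le past s a).trans (Nat.mul_le_mul_left H hm)
    _ ≤ _ := prob_exists_le _ _ _
    _ ≤ ∑ i ∈ (univ : Finset (St × Ac × St)) ×ˢ Icc 1 (H * K),
          2 * Real.exp (-(2 * logFactor St Ac H K δ)) := by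
        refine sum_le_sum fun i hi => ?_
        exact prob_deviation_le P s₁ alg (mem_Icc.1 (mem_product.1 hi).2).1 (by linarith) m _ _ _
    _ = _ := by
        rw [sum_const, card_product, card_univ, Nat.card_Icc, nsmul_eq_mul]
        simp
        ring

end Confidence

/-! ### Occupancies and the number of visits under the baseline policy -/

section Visits

variable {St : Type*} {Ac : Type*} [DecidableEq St] [DecidableEq Ac] {H K : ℕ}

/-- The number of visits of `(s, a)` in one episode. -/
def episodeVisits (τ : Episode St Ac H) (s : St) (a : Ac) : ℕ :=
  ∑ h : Fin H, if τ.1 h.castSucc = s ∧ τ.2 h = a then 1 else 0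

lemma episodeVisits_le (τ : Episode St Ac H) (s : St) (a : Ac) : episodeVisits τ s a ≤ H := by
  calc episodeVisits τ s a ≤ ∑ _h : Fin H, 1 := sum_le_sum fun h _ => by split_ifs <;> simp
    _ = H := by simp

lemma visits_firstEpisodes_mono (ω : Fin K → Episode St Ac H) {M m : ℕ} (hMm : M ≤ m) (hm : m ≤ K)
    (s : St) (a : Ac) :
    visits (firstEpisodes ω M (hMm.trans hm)) s a ≤ visits (firstEpisodes ω m hm) s a := by
  change ∑ j : Fin M, episodeVisits (firstEpisodes ω m hm (Fin.castLEEmb hMm j)) s a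
    ≤ ∑ j : Fin m, episodeVisits (firstEpisodes ω m hm j) s a
  rw [← sum_map univ (Fin.castLEEmb hMm) fun j => episodeVisits (firstEpisodes ω m hm j) s a]
  exact sum_le_sum_of_subset (subset_univ _)

variable [Fintype St] [Fintype Ac]

/-- The occupancy of `(s, a)`: the expected number of visits in one episode. -/
noncomputable def occupancy (P : Model St Ac) (s₁ : St) (π : Policy St Ac H) (s : St) (a : Ac) : ℝ :=
  expect (episodeLaw P s₁ H π) fun τ => (episodeVisits τ s a : ℝ)

lemma occupancy_nonneg (P : Model St Ac) (s₁ : St) (π : Policy St Ac H) (s : St) (a : Ac) :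
    0 ≤ occupancy P s₁ π s a :=
  expect_nonneg _ fun _ => Nat.cast_nonneg _

lemma value_eq_sum_occupancy (s₁ : St) (l : St → Ac → ℝ) (π : Policy St Ac H) (P : Model St Ac) :
    value s₁ l π P = ∑ x : St × Ac, occupancy P s₁ π x.1 x.2 * l x.1 x.2 := by
  simp only [occupancy, mul_comm _ (l _ _), ← expect_const_mul]
  rw [← expect_sum]
  change expect _ _ = _
  congr 1
  funext τ
  simp only [episodeVisits, Nat.cast_sum, mul_sum]
  rw [sum_comm]
  refine sum_congr rfl fun h _ => ?_
  rw [sum_eq_single (τ.1 h.castSucc, τ.2 h)]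
  · simp
  · rintro ⟨s, a⟩ - hne
    have : ¬ (τ.1 h.castSucc = s ∧ τ.2 h = a) := fun ⟨h1, h2⟩ => hne (by rw [h1, h2])
    simp [this]
  · simp

lemma sum_occupancy (P : Model St Ac) (s₁ : St) (π : Policy St Ac H) :
    ∑ x : St × Ac, occupancy P s₁ π x.1 x.2 = H := by
  have h := value_eq_sum_occupancy s₁ (fun _ _ => 1) π P
  simp only [mul_one] at h
  rw [← h]
  change expect _ _ = _
  simp [expect_const]

/-- On `[0, 1]` the convex function `exp (-x)` is below its chord, hence below `1 - x / 2`. -/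
lemma exp_neg_le_one_sub_half {x : ℝ} (h0 : 0 ≤ x) (h1 : x ≤ 1) : Real.exp (-x) ≤ 1 - x / 2 := by
  have h := convexOn_exp.2 (Set.mem_univ (-1 : ℝ)) (Set.mem_univ (0 : ℝ)) h0 (sub_nonneg.2 h1)
    (by ring)
  simp only [smul_eq_mul, mul_zero, add_zero, mul_neg, mul_one, Real.exp_zero] at h
  have he : Real.exp (-1) < 1 / 2 := by
    have := Real.exp_neg_one_lt_d9
    linarith
  nlinarith

lemma expect_exp_neg_episodeVisits_le (hH : 0 < H) (P : Model St Ac) (s₁ : St)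
    (π : Policy St Ac H) (s : St) (a : Ac) :
    expect (episodeLaw P s₁ H π) (fun τ => Real.exp (-(episodeVisits τ s a / H : ℝ)))
      ≤ Real.exp (-(occupancy P s₁ π s a / (2 * H))) := by
  have hH' : (0 : ℝ) < H := by exact_mod_cast hH
  have hsub : expect (episodeLaw P s₁ H π) (fun τ => 1 - (episodeVisits τ s a / H : ℝ) / 2)
      = 1 - occupancy P s₁ π s a / (2 * H) := by
    have h1 := expect_const (episodeLaw P s₁ H π) 1
    simp only [occupancy, expect] at h1 ⊢
    rw [← h1, sum_div, ← sum_sub_distrib, h1]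
    refine sum_congr rfl fun τ _ => ?_
    field_simp
  calc _ ≤ expect (episodeLaw P s₁ H π) (fun τ => 1 - (episodeVisits τ s a / H : ℝ) / 2) := by
        refine expect_mono _ fun τ => exp_neg_le_one_sub_half (by positivity) ?_
        rw [div_le_one hH']
        exact_mod_cast episodeVisits_le τ s a
    _ ≤ _ := by
        rw [hsub]
        have := Real.add_one_le_exp (-(occupancy P s₁ π s a / (2 * H)))
        linarith

/-- A multiplicative Chernoff bound: after `M` episodes of the policy `π`, it is unlikely that the
number of visits is below a quarter of its mean minus `H L`. -/
lemma prob_visits_lt_le (hH : 0 < H) {P : Model St Ac} {s₁ : St} {π : Policy St Ac H}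
    {alg : Algorithm St Ac H} {M : ℕ} (halg : ∀ k < M, ∀ past, alg k past = π) (L : ℝ)
    (s : St) (a : Ac) :
    prob (runLaw P s₁ alg M)
        {past | (visits past s a : ℝ) < M * occupancy P s₁ π s a / 4 - H * L}
      ≤ Real.exp (-L) := by
  have hH' : (0 : ℝ) < H := by exact_mod_cast hH
  set w := occupancy P s₁ π s a with hw
  have hw0 : 0 ≤ w := occupancy_nonneg P s₁ π s a
  have hmgf : expect (runLaw P s₁ alg M)
      (fun past => ∏ j, Real.exp (-(episodeVisits (past j) s a / H : ℝ)))
        ≤ Real.exp (-(w / (2 * H))) ^ M :=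
    expect_runLaw_prod_le (f := fun τ => Real.exp (-(episodeVisits τ s a / H : ℝ)))
      (fun τ => (Real.exp_pos _).le) M fun k hk past => by
        rw [halg k hk]
        exact expect_exp_neg_episodeVisits_le hH P s₁ π s a
  have hprod : ∀ past : Fin M → Episode St Ac H,
      ∏ j, Real.exp (-(episodeVisits (past j) s a / H : ℝ))
        = Real.exp (-(visits past s a / H : ℝ)) := by
    intro past
    rw [← Real.exp_sum, sum_neg_distrib, ← sum_div]
    congr 3
    exact (Nat.cast_sum _ _).symm
  simp only [hprod] at hmgf
  refine (prob_le_mul_expect _ (Real.exp_pos (M * w / (4 * H) - L)).le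
    (fun _ => (Real.exp_pos _).le) fun past hpast => ?_).trans
    ((mul_le_mul_of_nonneg_left hmgf (Real.exp_pos _).le).trans ?_)
  · rw [← Real.exp_add, Real.one_le_exp_iff]
    have : (visits past s a : ℝ) / H ≤ (M * w / 4 - H * L) / H :=
      div_le_div_of_nonneg_right (le_of_lt hpast) hH'.le
    have e : (M * w / 4 - H * L) / H = M * w / (4 * H) - L := by field_simp
    linarith
  · rw [← Real.exp_nat_mul, ← Real.exp_add, Real.exp_le_exp]
    have e : (M : ℝ) * -(w / (2 * H)) = -(2 * (M * w / (4 * H))) := by field_simp; ring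
    have : 0 ≤ M * w / (4 * H) := by positivity
    linarith

end Visits

/-! ### The pessimistic cost of the baseline policy -/

lemma sum_sqrt_le {ι : Type*} (t : Finset ι) {x : ι → ℝ} (hx : ∀ i ∈ t, 0 ≤ x i) :
    ∑ i ∈ t, √(x i) ≤ √(#t * ∑ i ∈ t, x i) := by
  refine Real.le_sqrt_of_sq_le ((sq_sum_le_card_mul_sum_sq).trans_eq ?_)
  rw [sum_congr rfl fun i hi => Real.sq_sqrt (hx i hi)]

section Pessimism

variable {St : Type*} {Ac : Type*} [DecidableEq St] [DecidableEq Ac] [Fintype St] {H m K : ℕ}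

lemma sum_transitions (past : Fin m → Episode St Ac H) (s : St) (a : Ac) :
    ∑ s', transitions past s a s' = visits past s a := by
  simp only [transitions, visits]
  rw [sum_comm]
  refine sum_congr rfl fun j _ => ?_
  rw [sum_comm]
  refine sum_congr rfl fun h _ => ?_
  rw [sum_eq_single ((past j).1 h.succ)]
  · simp
  · intro s' _ hne
    rw [if_neg fun h' => hne h'.2.2.symm]
  · simp

variable [Fintype Ac]

lemma totalRadius_le {δ : ℝ} (hL : 0 < logFactor St Ac H K δ) (past : Fin m → Episode St Ac H)
    (s : St) (a : Ac) :
    totalRadius K δ past s a ≤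
      √(4 * Fintype.card St * logFactor St Ac H K δ / max (visits past s a : ℝ) 1)
        + 14 * logFactor St Ac H K δ * Fintype.card St / (3 * max (visits past s a : ℝ) 1) := by
  set L := logFactor St Ac H K δ with hLdef
  set N : ℝ := max (visits past s a : ℝ) 1 with hN
  have hN0 : 0 < N := zero_lt_one.trans_le (le_max_right _ _)
  have he0 : ∀ s', 0 ≤ empModel past s a s' := fun s' => by
    unfold empModel
    positivity
  have hesum : ∑ s', empModel past s a s' ≤ 1 := by
    simp only [empModel]
    rw [← sum_div, ← Nat.cast_sum, sum_transitions, div_le_one hN0]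
    exact le_max_left _ _
  have hsqrt : ∑ s', √(4 * (empModel past s a s' * (1 - empModel past s a s')) * L / N)
      ≤ √(4 * Fintype.card St * L / N) := by
    calc _ ≤ ∑ s', √(4 * L / N * empModel past s a s') := by
          refine sum_le_sum fun s' _ => Real.sqrt_le_sqrt ?_
          have : empModel past s a s' * (1 - empModel past s a s') ≤ empModel past s a s' := by
            nlinarith [he0 s']
          calc _ = 4 * L / N * (empModel past s a s' * (1 - empModel past s a s')) := by ring
            _ ≤ _ := mul_le_mul_of_nonneg_left this (by positivity)
      _ ≤ _ := sum_sqrt_le _ fun s' _ => mul_nonneg (by positivity) (he0 s')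
      _ ≤ _ := by
          refine Real.sqrt_le_sqrt ?_
          rw [← mul_sum, card_univ]
          calc _ ≤ (Fintype.card St : ℝ) * (4 * L / N * 1) := by gcongr
            _ = _ := by ring
  simp only [totalRadius, radius, sum_add_distrib, ← hLdef, ← hN]
  refine add_le_add hsqrt (le_of_eq ?_)
  rw [sum_const, card_univ, nsmul_eq_mul]
  ring

/-- The contribution of one state-action pair of occupancy `w` with `n` observed visits. If
`n ≥ H L`, the hypothesis gives `w ≤ 8 n / M`; otherwise it gives `w ≤ 8 H L / M`. -/
lemma occupancy_mul_radius_le {S H L M n w : ℝ} (hS : 1 ≤ S) (hH : 1 ≤ H) (hL : 2 / 3 < L)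
    (hM : 0 < M) (hn : 1 ≤ n) (hw : 0 ≤ w) (hwn : M * w / 4 - H * L ≤ n) :
    w * (√(4 * S * L / n) + 14 * L * S / (3 * n))
      ≤ √w * √(32 * S * L / M) + 70 * S * H * L ^ 2 / M := by
  have hHL : 2 / 3 < H * L := by nlinarith
  have hSL : 2 / 3 < S * L := by nlinarith
  have hw' : w ≤ 4 * (n + H * L) / M := by
    rw [le_div_iff₀ hM]
    linarith
  have h1 : w * √(4 * S * L / n) ≤ √w * √(32 * S * L / M) + 20 * S * H * L ^ 2 / M := by
    rcases le_total (H * L) n with h | h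
    · have hwn' : w ≤ 8 * n / M :=
        hw'.trans (div_le_div_of_nonneg_right (by linarith) hM.le)
      have : w * √(4 * S * L / n) ≤ √w * √(32 * S * L / M) := by
        calc w * √(4 * S * L / n) = √w * (√w * √(4 * S * L / n)) := by
              rw [← mul_assoc, Real.mul_self_sqrt hw]
          _ = √w * √(w * (4 * S * L / n)) := by rw [Real.sqrt_mul hw]
          _ ≤ √w * √(8 * n / M * (4 * S * L / n)) := by gcongr
          _ = √w * √(32 * S * L / M) := by
              congr 2
              field_simp
              ring
      have : 0 ≤ 20 * S * H * L ^ 2 / M := by positivity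
      linarith
    · have hwn' : w ≤ 8 * (H * L) / M :=
        hw'.trans (div_le_div_of_nonneg_right (by linarith) hM.le)
      have hs : √(4 * S * L / n) ≤ 5 / 2 * (S * L) := by
        refine Real.sqrt_le_iff.2 ⟨by positivity, ?_⟩
        calc 4 * S * L / n ≤ 4 * S * L := div_le_self (by positivity) hn
          _ ≤ _ := by nlinarith
      calc w * √(4 * S * L / n) ≤ 8 * (H * L) / M * (5 / 2 * (S * L)) := by gcongr
        _ = 20 * S * H * L ^ 2 / M := by ring
        _ ≤ _ := le_add_of_nonneg_left (by positivity)
  have h2 : w * (14 * L * S / (3 * n)) ≤ 50 * S * H * L ^ 2 / M := by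
    have hwn' : w / n ≤ 10 * (H * L) / M := by
      rw [div_le_iff₀ (by linarith)]
      have : 4 * (n + H * L) ≤ 10 * (H * L) * n := by
        nlinarith [mul_nonneg (sub_nonneg.2 hHL.le) (sub_nonneg.2 hn)]
      exact hw'.trans ((div_le_div_of_nonneg_right this hM.le).trans_eq (by ring))
    calc w * (14 * L * S / (3 * n)) = w / n * (14 / 3 * (L * S)) := by field_simp
      _ ≤ 10 * (H * L) / M * (14 / 3 * (L * S)) := by gcongr
      _ = 140 / 3 * (S * H * L ^ 2 / M) := by ring
      _ ≤ 50 * (S * H * L ^ 2 / M) := by gcongr; norm_num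
      _ = _ := by ring
  calc _ = w * √(4 * S * L / n) + w * (14 * L * S / (3 * n)) := by ring
    _ ≤ _ := add_le_add h1 h2
    _ = _ := by ring

/-- If all visit counts are not much below their means under `M` episodes of `π`, the expected
summed radius along an episode of `π` is `O(√(S² A H L / M) + S² A H L² / M)`. -/
lemma value_totalRadius_le {δ : ℝ} {M : ℝ} (hH : 0 < H) (hL : 2 / 3 < logFactor St Ac H K δ)
    (hM : 0 < M) (P : Model St Ac) (s₁ : St) (π : Policy St Ac H)
    (past : Fin m → Episode St Ac H)
    (hvis : ∀ s a, M * occupancy P s₁ π s a / 4 - H * logFactor St Ac H K δ ≤ visits past s a) :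
    value s₁ (totalRadius K δ past) π P
      ≤ √(32 * (Fintype.card St ^ 2 * Fintype.card Ac * H) * logFactor St Ac H K δ / M)
        + 70 * (Fintype.card St ^ 2 * Fintype.card Ac * H) * logFactor St Ac H K δ ^ 2 / M := by
  set L := logFactor St Ac H K δ with hLdef
  have hS : (1 : ℝ) ≤ Fintype.card St := by exact_mod_cast Fintype.card_pos_iff.2 ⟨s₁⟩
  have hH' : (1 : ℝ) ≤ H := by exact_mod_cast hH
  have hterm : ∀ x : St × Ac, occupancy P s₁ π x.1 x.2 * totalRadius K δ past x.1 x.2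
      ≤ √(occupancy P s₁ π x.1 x.2) * √(32 * Fintype.card St * L / M)
        + 70 * Fintype.card St * H * L ^ 2 / M := fun x =>
    (mul_le_mul_of_nonneg_left (totalRadius_le (by linarith) past x.1 x.2)
      (occupancy_nonneg P s₁ π x.1 x.2)).trans
    (occupancy_mul_radius_le hS hH' hL hM (le_max_right _ _) (occupancy_nonneg P s₁ π x.1 x.2)
      ((hvis x.1 x.2).trans (le_max_left _ _)))
  rw [value_eq_sum_occupancy]
  refine (sum_le_sum fun x _ => hterm x).trans ?_
  rw [sum_add_distrib, ← sum_mul, sum_const, card_univ, Fintype.card_prod, nsmul_eq_mul]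
  refine add_le_add ?_ (le_of_eq (by push_cast; ring))
  calc _ ≤ √(#(univ : Finset (St × Ac)) * ∑ x : St × Ac, occupancy P s₁ π x.1 x.2)
        * √(32 * Fintype.card St * L / M) := by
        gcongr
        exact sum_sqrt_le _ fun x _ => occupancy_nonneg P s₁ π x.1 x.2
    _ = _ := by
        rw [sum_occupancy, card_univ, Fintype.card_prod, ← Real.sqrt_mul (by positivity)]
        congr 1
        push_cast
        ring

lemma value_pessCost (s₁ : St) (c : St → Ac → ℝ) (π : Policy St Ac H) (P : Model St Ac) (δ : ℝ)
    (past : Fin m → Episode St Ac H) :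
    value s₁ (pessCost K δ c past) π P
      = value s₁ c π P + H * value s₁ (totalRadius K δ past) π P := by
  simp only [value_eq_sum_occupancy, mul_sum, ← sum_add_distrib, pessCost]
  exact sum_congr rfl fun x _ => by ring

/-- The choice of the number of baseline episodes: `200 S² A H³ L² / g² ≤ M` makes the pessimistic
surplus at most the slack `g`. Here `W` stands for `S² A H`. -/
lemma mul_sqrt_add_le_gap {W H L M g : ℝ} (hW : 0 ≤ W) (hH : 1 ≤ H) (hL : 2 / 3 < L) (hM : 0 < M)
    (hg : 0 < g) (hgH : g ≤ H) (h : 200 * (W * H ^ 2 / g ^ 2) * L ^ 2 ≤ M) :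
    H * (√(32 * W * L / M) + 70 * W * L ^ 2 / M) ≤ g := by
  set T := W * H ^ 2 / g ^ 2 with hT
  have hT0 : 0 ≤ T := by positivity
  have hWT : W * H ^ 2 = T * g ^ 2 := by rw [hT]; field_simp
  have h1 : H * √(32 * W * L / M) ≤ g / 2 := by
    have h128 : 128 * (T * L) ≤ M := by nlinarith [mul_nonneg hT0 (by linarith : 0 ≤ L)]
    rw [← Real.sqrt_sq (by linarith : 0 ≤ H), ← Real.sqrt_mul (by positivity)]
    refine Real.sqrt_le_iff.2 ⟨by linarith, ?_⟩
    rw [← mul_div_assoc, div_le_iff₀ hM]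
    calc H ^ 2 * (32 * W * L) = 32 * (W * H ^ 2) * L := by ring
      _ = g ^ 2 / 4 * (128 * (T * L)) := by rw [hWT]; ring
      _ ≤ g ^ 2 / 4 * M := by gcongr
      _ = _ := by ring
  have h2 : H * (70 * W * L ^ 2 / M) ≤ g / 2 := by
    rw [← mul_div_assoc, div_le_iff₀ hM]
    refine le_of_mul_le_mul_left ?_ (by linarith : 0 < H)
    calc H * (H * (70 * W * L ^ 2)) = 70 * (W * H ^ 2) * L ^ 2 := by ring
      _ = g * g * (70 * (T * L ^ 2)) := by rw [hWT]; ring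
      _ ≤ g * H * (M / 2) := by
          gcongr
          nlinarith [mul_nonneg hT0 (sq_nonneg L)]
      _ = _ := by ring
  linarith

end Pessimism

/-! ### Feasibility of the baseline pair -/

section Feasibility

variable {St : Type*} {Ac : Type*} [Fintype St] [Fintype Ac] [DecidableEq St] [DecidableEq Ac]
  {H K : ℕ}

lemma isOPFeasible_of_good {s₁ : St} {P : Model St Ac} {c : St → Ac → ℝ} {πb : Policy St Ac H}
    {Cbar δ : ℝ} {m : ℕ} {past : Fin m → Episode St Ac H} {M : ℝ} (hH : 0 < H)
    (hg : value s₁ c πb P < Cbar) (hgH : Cbar - value s₁ c πb P ≤ H)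
    (hL : 2 / 3 < logFactor St Ac H K δ) (hM : 0 < M)
    (hMge : 200 * (Fintype.card St ^ 2 * Fintype.card Ac * (H : ℝ) ^ 3 /
      (Cbar - value s₁ c πb P) ^ 2) * logFactor St Ac H K δ ^ 2 ≤ M)
    (hmem : P ∈ confidenceSet K δ past)
    (hvis : ∀ s a, M * occupancy P s₁ πb s a / 4 - H * logFactor St Ac H K δ ≤ visits past s a) :
    IsOPFeasible K δ s₁ c Cbar past πb P := by
  refine ⟨hmem, ?_⟩
  have h1 := value_totalRadius_le hH hL hM P s₁ πb past hvis
  have h2 := mul_sqrt_add_le_gap (W := Fintype.card St ^ 2 * Fintype.card Ac * (H : ℝ))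
    (by positivity) (by exact_mod_cast hH) hL hM (sub_pos.2 hg) hgH (by
      refine le_of_eq_of_le ?_ hMge
      ring)
  rw [value_pessCost]
  have := mul_le_mul_of_nonneg_left h1 (Nat.cast_nonneg (α := ℝ) H)
  linarith

/-- The two failure probabilities add up to at most `δ`, because
`exp (-L) = δ / (2 S A H K)`. -/
lemma failure_le {S A H K δ : ℝ} (hS : 1 ≤ S) (hA : 1 ≤ A) (hH : 1 ≤ H) (hK : 1 ≤ K)
    (hδ0 : 0 < δ) (hδ1 : δ < 1) :
    K * (S ^ 2 * A * H * K * (2 * Real.exp (-(2 * Real.log (2 * S * A * H * K / δ)))))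
      + S * A * Real.exp (-Real.log (2 * S * A * H * K / δ)) ≤ δ := by
  have hx : 0 < 2 * S * A * H * K / δ := by positivity
  have he : Real.exp (-Real.log (2 * S * A * H * K / δ)) = δ / (2 * S * A * H * K) := by
    rw [Real.exp_neg, Real.exp_log hx, inv_div]
  have he2 : Real.exp (-(2 * Real.log (2 * S * A * H * K / δ)))
      = (δ / (2 * S * A * H * K)) ^ 2 := by
    rw [← he, ← Real.exp_nat_mul]
    congr 1
    push_cast
    ring
  have hAH : 1 ≤ A * H := one_le_mul_of_one_le_of_one_le hA hH
  have hHK : 1 ≤ H * K := one_le_mul_of_one_le_of_one_le hH hK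
  rw [he, he2]
  have e1 : K * (S ^ 2 * A * H * K * (2 * (δ / (2 * S * A * H * K)) ^ 2))
      = δ ^ 2 / 2 / (A * H) := by
    field_simp
  have e2 : S * A * (δ / (2 * S * A * H * K)) = δ / 2 / (H * K) := by
    field_simp
  rw [e1, e2]
  have h1 : δ ^ 2 / 2 / (A * H) ≤ δ ^ 2 / 2 := div_le_self (by positivity) hAH
  have h2 : δ / 2 / (H * K) ≤ δ / 2 := div_le_self (by positivity) hHK
  nlinarith

/-- With probability at least `1 - δ`, all confidence sets contain the true model and all visit
counts after the first `M` episodes, played with `πb`, are not much below their means. -/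
lemma prob_good_ge (hH : 0 < H) {P : Model St Ac} {s₁ : St} {πb : Policy St Ac H}
    {alg : Algorithm St Ac H} {δ : ℝ} (hδ : δ ∈ Set.Ioo (0 : ℝ) 1) {M : ℕ} (hMK : M ≤ K)
    (hK : 0 < K) (hA : 0 < Fintype.card Ac) (hL : 2 / 3 < logFactor St Ac H K δ)
    (halg : ∀ k < M, ∀ past, alg k past = πb) :
    1 - δ ≤ prob (runLaw P s₁ alg K) {ω | (∀ m (hm : m < K),
        P ∈ confidenceSet K δ (firstEpisodes ω m hm.le)) ∧
      ∀ s a, M * occupancy P s₁ πb s a / 4 - H * logFactor St Ac H K δ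
        ≤ visits (firstEpisodes ω M hMK) s a} := by
  set L := logFactor St Ac H K δ with hLdef
  have hbad : prob (runLaw P s₁ alg K)
      ({ω | ∃ m ∈ (univ : Finset (Fin K)),
          ω ∈ {ω | firstEpisodes ω m m.isLt.le ∈ {past | P ∉ confidenceSet K δ past}}} ∪
        {ω | ∃ x ∈ (univ : Finset (St × Ac)), ω ∈ {ω | firstEpisodes ω M hMK ∈
          {past | (visits past x.1 x.2 : ℝ) < M * occupancy P s₁ πb x.1 x.2 / 4 - H * L}}}) ≤ δ := by
    refine (prob_union_le _ _ _).trans ?_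
    refine (add_le_add (prob_exists_le _ _ _) (prob_exists_le _ _ _)).trans ?_
    simp only [prob_runLaw_firstEpisodes]
    refine (add_le_add
      (sum_le_sum fun m _ => prob_notMem_confidenceSet_le P s₁ alg hL m.isLt.le)
      (sum_le_sum fun x _ => prob_visits_lt_le hH halg L x.1 x.2)).trans ?_
    rw [sum_const, sum_const, card_univ, card_univ, Fintype.card_fin, Fintype.card_prod,
      nsmul_eq_mul, nsmul_eq_mul]
    push_cast
    exact failure_le (by exact_mod_cast Fintype.card_pos_iff.2 ⟨s₁⟩) (by exact_mod_cast hA)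
      (by exact_mod_cast hH) (by exact_mod_cast hK) hδ.1 hδ.2
  rw [sub_le_comm, ← prob_compl]
  refine (prob_mono _ fun ω hω => ?_).trans hbad
  by_contra hcon
  simp only [Set.mem_union, Set.mem_ofPred_eq, mem_univ, true_and, not_or, not_exists,
    not_not, not_lt] at hcon
  exact hω ⟨fun m hm => hcon.1 ⟨m, hm⟩, fun s a => hcon.2 (s, a)⟩

end Feasibility

end OPSRL

theorem proposition1 :
    ∃ (C : ℝ) (p : ℕ), 0 < C ∧
      ∀ (St : Type*) (Ac : Type*) [Fintype St] [Fintype Ac] [DecidableEq St] [DecidableEq Ac]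
        (H K : ℕ) (s₁ : St) (P : OPSRL.Model St Ac) (r c : St → Ac → ℝ)
        (πb : OPSRL.Policy St Ac H) (Cbar Cb δ : ℝ) (Ko : ℕ) (alg : OPSRL.Algorithm St Ac H),
        0 < H →
        (∀ s a, r s a ∈ Set.Icc (0 : ℝ) 1) →
        (∀ s a, c s a ∈ Set.Icc (0 : ℝ) 1) →
        OPSRL.value s₁ c πb P = Cb →
        Cb < Cbar →
        Cbar - Cb ≤ H →
        δ ∈ Set.Ioo (0 : ℝ) 1 →
        C * ((Fintype.card St : ℝ) ^ 2 * Fintype.card Ac * (H : ℝ) ^ 3 / (Cbar - Cb) ^ 2)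
            * OPSRL.logFactor St Ac H K δ ^ p ≤ Ko →
        OPSRL.IsOPSRL K δ s₁ r c πb Cb Cbar Ko alg →
        1 - 3 * δ <
          ((OPSRL.runLaw P s₁ alg K).toOuterMeasure
            {ω | ∀ (m : ℕ) (hm : m + 1 ≤ K), Ko ≤ m + 1 →
              OPSRL.IsOPFeasible K δ s₁ c Cbar
                (OPSRL.firstEpisodes ω m (Nat.le_of_succ_le hm)) πb P}).toReal := by
  refine ⟨400, 2, by norm_num, ?_⟩
  intro St Ac _ _ _ _ H K s₁ P r c πb Cbar Cb δ Ko alg hH _ _ hCb hg hgH hδ hKo halg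
  have hδ0 := hδ.1
  refine lt_of_lt_of_le (by linarith : 1 - 3 * δ < 1 - δ) ?_
  change _ ≤ OPSRL.prob _ _
  -- Without an episode `k ≥ Ko` there is nothing to show; this covers `K = 0`, where `L = 0`.
  by_cases htriv : K = 0 ∨ K < Ko
  · have huniv : ∀ s : Set (Fin K → OPSRL.Episode St Ac H), (∀ ω, ω ∈ s) →
        1 - δ ≤ OPSRL.prob (OPSRL.runLaw P s₁ alg K) s := by
      intro s hs
      have hempty : OPSRL.prob (OPSRL.runLaw P s₁ alg K) sᶜ = 0 := by
        rw [Set.eq_univ_of_forall hs, Set.compl_univ, OPSRL.prob, MeasureTheory.measure_empty,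
          ENNReal.toReal_zero]
      linarith [OPSRL.prob_compl (OPSRL.runLaw P s₁ alg K) s]
    exact huniv _ fun ω m hm hmKo => by omega
  push Not at htriv
  obtain ⟨hK0, hKoK⟩ := htriv
  have hK : 0 < K := Nat.pos_of_ne_zero hK0
  have hA : 0 < Fintype.card Ac := by
    obtain ⟨a, -⟩ := (πb ⟨0, hH⟩ s₁).support_nonempty
    exact Fintype.card_pos_iff.2 ⟨a⟩
  have hS1 : (1 : ℝ) ≤ Fintype.card St := by exact_mod_cast Fintype.card_pos_iff.2 ⟨s₁⟩
  have hA1 : (1 : ℝ) ≤ Fintype.card Ac := by exact_mod_cast hA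
  have hH1 : (1 : ℝ) ≤ H := by exact_mod_cast hH
  have hK1 : (1 : ℝ) ≤ K := by exact_mod_cast hK
  have hL : 2 / 3 < OPSRL.logFactor St Ac H K δ := by
    have h2 : (2 : ℝ) ≤ 2 * Fintype.card St * Fintype.card Ac * H * K / δ := by
      rw [le_div_iff₀ hδ0]
      have : (1 : ℝ) ≤ Fintype.card St * Fintype.card Ac * H * K :=
        one_le_mul_of_one_le_of_one_le (one_le_mul_of_one_le_of_one_le
          (one_le_mul_of_one_le_of_one_le hS1 hA1) hH1) hK1
      linarith [hδ.2]
    have := Real.log_le_log two_pos h2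
    have := Real.log_two_gt_d9
    unfold OPSRL.logFactor
    linarith
  subst hCb
  have hgap := sub_pos.2 hg
  -- As the slack is at most `H`, the bound on `Ko` exceeds `2`, so that `Ko - 1 ≥ Ko / 2`.
  have hT : 1 ≤ (Fintype.card St : ℝ) ^ 2 * Fintype.card Ac * (H : ℝ) ^ 3 /
      (Cbar - OPSRL.value s₁ c πb P) ^ 2 := by
    rw [one_le_div (by positivity)]
    calc (Cbar - OPSRL.value s₁ c πb P) ^ 2 ≤ (H : ℝ) ^ 2 := by gcongr
      _ ≤ (H : ℝ) ^ 3 := pow_le_pow_right₀ hH1 (by norm_num)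
      _ ≤ _ := le_mul_of_one_le_left (by positivity)
          (one_le_mul_of_one_le_of_one_le (one_le_pow₀ hS1) hA1)
  have hKo2 : (2 : ℝ) ≤ Ko := by
    refine le_trans ?_ hKo
    nlinarith [sq_nonneg (OPSRL.logFactor St Ac H K δ)]
  have hKo2' : 2 ≤ Ko := by exact_mod_cast hKo2
  have hcast : ((Ko - 1 : ℕ) : ℝ) = Ko - 1 := by
    rw [Nat.cast_sub (by omega), Nat.cast_one]
  refine (OPSRL.prob_good_ge (M := Ko - 1) hH hδ (by omega) hK hA hL
    fun k hk past => halg.baseline k past (by omega)).trans (OPSRL.prob_mono _ ?_)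
  rintro ω ⟨hmem, hvis⟩ m hm hmKo
  refine OPSRL.isOPFeasible_of_good (M := ((Ko - 1 : ℕ) : ℝ)) hH hg hgH hL (by linarith)
    (by linarith) (hmem m hm) fun s a => (hvis s a).trans ?_
  exact_mod_cast OPSRL.visits_firstEpisodes_mono ω (by omega : Ko - 1 ≤ m) _ s a
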